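/- Let $A$ be a noetherian commutative ring, let $\mathfrak{a}$ be an ideal in $A$, and let $M$ be an $A$-module. Assume that: 1. $M$ is $\mathfrak{a}$-adically complete, i.e. the canonical homomorphism $M \to \varprojlim_k M/\mathfrak{a}^{k+1}M$, $m \mapsto (m + \mathfrak{a}^{k+1}M)_{k\ge 0}$, is bijective; 2. $M$ is $\mathfrak{a}$-adically flat, i.e. $\operatorname{Tor}^A_i(N, M) = 0$ for every $i > 0$ and every $\mathfrak{a}$-torsion $A$-module $N$, where $N$ is called $\mathfrak{a}$-torsion if each of its elements is annihilated by some power of $\mathfrak{a}$. Then $M$ is a flat $A$-module. -/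

import Mathlib

universe u

/-- An `A`-module `N` is `𝔞`-torsion if every element of `N` is annihilated by some power
of the ideal `𝔞`. -/
def IsAdicTorsion {A : Type u} [CommRing A] (𝔞 : Ideal A)
    (N : Type u) [AddCommGroup N] [Module A N] : Prop :=
  ∀ x : N, ∃ k : ℕ, ∀ a ∈ 𝔞 ^ k, a • x = 0

/-- An `A`-module `M` is `𝔞`-adically flat if `Tor_i^A(N, M) = 0` for every `𝔞`-torsion
`A`-module `N` and every `i > 0`. -/
def IsAdicallyFlat {A : Type u} [CommRing A] (𝔞 : Ideal A)
    (M : Type u) [AddCommGroup M] [Module A M] : Prop :=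
  ∀ (N : Type u) [AddCommGroup N] [Module A N], IsAdicTorsion 𝔞 N →
    ∀ i : ℕ, 0 < i → CategoryTheory.Limits.IsZero
      (((CategoryTheory.Tor (ModuleCat.{u} A) i).obj (ModuleCat.of A N)).obj (ModuleCat.of A M))

/-! Let `x` die under `I ⊗ M → A ⊗ M`. Artin–Rees makes `I / (I ∩ 𝔞 ^ m)` a submodule of the torsion
module `A / 𝔞 ^ m`; adic flatness keeps this inclusion injective after tensoring with `M`, which
puts `x` in `𝔞 ^ k (I ⊗ M)` for every `k`. It remains that `N ⊗ M` is Hausdorff for every finite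
`N`. Write `N = A ^ n / K`: then `K ⊗ M` is precomplete, `A ^ n ⊗ M ≅ M ^ n` is complete, and the
same Artin–Rees estimate shows that the image of `K ⊗ M` is closed. -/

open CategoryTheory TensorProduct in
/-- If `Tor₁(Y₃, M) = 0`, tensoring a short exact sequence `0 → Y₁ → Y₂ → Y₃ → 0` with `M`
preserves injectivity of the first map. -/
theorem rTensor_injective_of_isZero_Tor_one {A : Type u} [CommRing A]
    {M Y₁ Y₂ Y₃ : Type u} [AddCommGroup M] [Module A M] [AddCommGroup Y₁] [Module A Y₁]
    [AddCommGroup Y₂] [Module A Y₂] [AddCommGroup Y₃] [Module A Y₃]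
    {f : Y₁ →ₗ[A] Y₂} {g : Y₂ →ₗ[A] Y₃} (hf : Function.Injective f)
    (hfg : Function.Exact f g) (hg : Function.Surjective g)
    (h : Limits.IsZero (((Tor (ModuleCat.{u} A) 1).obj (ModuleCat.of A Y₃)).obj
      (ModuleCat.of A M))) :
    Function.Injective (f.rTensor M) := by
  let P := projectiveResolution (ModuleCat.of A M)
  let P0 := P.complex.X 0
  let P1 := P.complex.X 1
  let P2 := P.complex.X 2
  let d1 : P1 →ₗ[A] P0 := (P.complex.d 1 0).hom
  let d2 : P2 →ₗ[A] P1 := (P.complex.d 2 1).hom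
  let ε : P0 →ₗ[A] M := (P.π.f 0).hom
  have hε : Function.Surjective ε := (ModuleCat.epi_iff_surjective (P.π.f 0)).1 inferInstance
  have hd1 : Function.Exact d1 ε :=
    (ShortComplex.ShortExact.moduleCat_exact_iff_function_exact _).1 P.exact₀
  have hd : d1 ∘ₗ d2 = 0 := congrArg ModuleCat.Hom.hom (P.complex.d_comp_d 2 1 0)
  have proj0 : Module.Projective A P0 := (IsProjective.iff_projective _).2 (P.projective 0)
  have proj1 : Module.Projective A P1 := (IsProjective.iff_projective _).2 (P.projective 1)
  -- Vanishing of Tor₁ is exactness of `Y₃ ⊗ P` in degree 1.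
  have hY : Function.Exact (d2.lTensor Y₃) (d1.lTensor Y₃) := by
    let F := (MonoidalCategory.tensoringLeft (ModuleCat.{u} A)).obj (ModuleCat.of A Y₃)
    let C := (F.mapHomologicalComplex (ComplexShape.down ℕ)).obj P.complex
    have hC : Limits.IsZero (C.homology 1) :=
      Limits.IsZero.of_iso h (P.isoLeftDerivedObj F 1).symm
    have hC' : C.ExactAt 1 := (HomologicalComplex.exactAt_iff_isZero_homology _ _).2 hC
    rw [C.exactAt_iff' 2 1 0 (by simp) (by simp)] at hC'
    exact (ShortComplex.ShortExact.moduleCat_exact_iff_function_exact _).1 hC'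
  have comm {U V : Type u} [AddCommGroup U] [Module A U] [AddCommGroup V] [Module A V]
      {S T : Type u} [AddCommGroup S] [Module A S] [AddCommGroup T] [Module A T]
      (a : U →ₗ[A] V) (b : S →ₗ[A] T) (z : U ⊗[A] S) :
      a.rTensor T (b.lTensor U z) = b.lTensor V (a.rTensor S z) := by
    rw [← LinearMap.comp_apply, ← LinearMap.comp_apply, LinearMap.rTensor_comp_lTensor,
      LinearMap.lTensor_comp_rTensor]
  rw [injective_iff_map_eq_zero]
  intro x hx
  obtain ⟨x0, rfl⟩ := LinearMap.lTensor_surjective Y₁ hε x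
  rw [comm] at hx
  obtain ⟨y1, hy1⟩ := (lTensor_exact Y₂ hd1 hε _).1 hx
  have hz : d1.lTensor Y₃ (g.rTensor P1 y1) = 0 := by
    rw [← comm, hy1, ← LinearMap.comp_apply, ← LinearMap.rTensor_comp, hfg.linearMap_comp_eq_zero]
    simp
  obtain ⟨z2, hz2⟩ := (hY _).1 hz
  obtain ⟨w2, rfl⟩ := LinearMap.rTensor_surjective P2 hg z2
  -- Correcting `y1` by a boundary leaves its image under `d1` unchanged and makes it come from `Y₁
  -- ⊗ P1`.
  have hv : g.rTensor P1 (y1 - d2.lTensor Y₂ w2) = 0 := by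
    rw [map_sub, comm, hz2, sub_self]
  obtain ⟨v, hv⟩ := (rTensor_exact P1 hfg hg _).1 hv
  have hinj := Module.Flat.rTensor_preserves_injective_linearMap (M := P0) f hf
  have hx0 : x0 = d1.lTensor Y₁ v := by
    apply hinj
    rw [comm, hv, map_sub, hy1, ← LinearMap.comp_apply (d1.lTensor Y₂), ← LinearMap.lTensor_comp,
      hd]
    simp
  rw [hx0, ← LinearMap.comp_apply, ← LinearMap.lTensor_comp, hd1.linearMap_comp_eq_zero]
  simp

-- Torsion passes to the cokernel of `f`, so its Tor₁ with `M` vanishes.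
open TensorProduct in
theorem IsAdicallyFlat.rTensor_injective {A : Type u} [CommRing A] {𝔞 : Ideal A}
    {M Y₁ Y₂ : Type u} [AddCommGroup M] [Module A M] [AddCommGroup Y₁] [Module A Y₁]
    [AddCommGroup Y₂] [Module A Y₂] (hM : IsAdicallyFlat 𝔞 M) (hY : IsAdicTorsion 𝔞 Y₂)
    {f : Y₁ →ₗ[A] Y₂} (hf : Function.Injective f) : Function.Injective (f.rTensor M) := by
  refine rTensor_injective_of_isZero_Tor_one (g := f.range.mkQ) hf
    (LinearMap.exact_map_mkQ_range f) (Submodule.mkQ_surjective _) (hM _ ?_ 1 one_pos)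
  intro y
  obtain ⟨y, rfl⟩ := Submodule.mkQ_surjective _ y
  obtain ⟨k, hk⟩ := hY y
  exact ⟨k, fun a ha => by rw [← map_smul, hk a ha, map_zero]⟩

theorem Submodule.map_mem_smul_top {A X Y : Type*} [CommRing A] [AddCommGroup X] [Module A X]
    [AddCommGroup Y] [Module A Y] (I : Ideal A) (f : X →ₗ[A] Y) {x : X}
    (hx : x ∈ I • (⊤ : Submodule A X)) : f x ∈ I • (⊤ : Submodule A Y) := by
  have h := Submodule.mem_map_of_mem (f := f) hx
  rw [Submodule.map_smul''] at h
  exact Submodule.smul_mono le_rfl le_top h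

theorem Submodule.exists_mem_smul_top_map_eq {A X Y : Type*} [CommRing A] [AddCommGroup X]
    [Module A X] [AddCommGroup Y] [Module A Y] (I : Ideal A) {f : X →ₗ[A] Y}
    (hf : Function.Surjective f) {y : Y} (hy : y ∈ I • (⊤ : Submodule A Y)) :
    ∃ x ∈ I • (⊤ : Submodule A X), f x = y := by
  rwa [← LinearMap.range_eq_top.2 hf, ← Submodule.map_top, ← Submodule.map_smul''] at hy

open TensorProduct in
/-- Artin–Rees for `N ⊗ M`, where `N` is a submodule of a finite module and `M` is adically flat. -/
theorem IsAdicallyFlat.exists_rTensor_mem_pow_smul_imp {A : Type u} [CommRing A]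
    [IsNoetherianRing A] {𝔞 : Ideal A} {M F : Type u} [AddCommGroup M] [Module A M]
    [AddCommGroup F] [Module A F] [Module.Finite A F] (hM : IsAdicallyFlat 𝔞 M)
    (N : Submodule A F) (k : ℕ) :
    ∃ m : ℕ, ∀ w : N ⊗[A] M, N.subtype.rTensor M w ∈ 𝔞 ^ m • (⊤ : Submodule A (F ⊗[A] M)) →
      w ∈ 𝔞 ^ k • (⊤ : Submodule A (N ⊗[A] M)) := by
  obtain ⟨c, hc⟩ := 𝔞.exists_pow_inf_eq_pow_smul N
  -- With `c` the Artin–Rees constant, `𝔞 ^ m F ∩ N = 𝔞 ^ k (𝔞 ^ c F ∩ N) ⊆ 𝔞 ^ k N`.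
  let m := c + k
  let J : Submodule A F := 𝔞 ^ m • ⊤
  let L : Submodule A N := J.comap N.subtype
  have hL : L ≤ 𝔞 ^ k • ⊤ := by
    rintro ⟨x, hxN⟩ hx
    have h : x ∈ 𝔞 ^ m • ⊤ ⊓ N := ⟨hx, hxN⟩
    rw [hc m (Nat.le_add_right c k), Nat.add_sub_cancel_left] at h
    have h' : x ∈ 𝔞 ^ k • N := Submodule.smul_mono le_rfl inf_le_right h
    have e : 𝔞 ^ k • N = (𝔞 ^ k • (⊤ : Submodule A N)).map N.subtype := by
      rw [Submodule.map_smul'', Submodule.map_subtype_top]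
    rw [e] at h'
    obtain ⟨y, hy, rfl⟩ := h'
    exact hy
  have htors : IsAdicTorsion 𝔞 (F ⧸ J) := by
    intro y
    obtain ⟨y, rfl⟩ := Submodule.mkQ_surjective _ y
    refine ⟨m, fun a ha => ?_⟩
    rw [← map_smul, Submodule.mkQ_apply, Submodule.Quotient.mk_eq_zero]
    exact Submodule.smul_mem_smul ha trivial
  let j : (N ⧸ L) →ₗ[A] F ⧸ J := L.mapQ J N.subtype le_rfl
  have hj : Function.Injective j := by
    rw [← LinearMap.ker_eq_bot, Submodule.ker_mapQ, Submodule.mkQ_map_self]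
  have hjM := hM.rTensor_injective htors hj
  refine ⟨m, fun w hw => ?_⟩
  have h0 : J.mkQ.rTensor M (N.subtype.rTensor M w) = 0 := by
    have hmap := Submodule.map_mem_smul_top (𝔞 ^ m) (J.mkQ.rTensor M) hw
    have hbot : 𝔞 ^ m • (⊤ : Submodule A ((F ⧸ J) ⊗[A] M)) = ⊥ := by
      rw [eq_bot_iff, Submodule.smul_le]
      intro a ha t _
      induction t with
      | zero => simp
      | add s t hs ht => rw [smul_add]; exact add_mem (hs trivial) (ht trivial)
      | tmul y z =>
        obtain ⟨y, rfl⟩ := Submodule.mkQ_surjective _ y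
        rw [smul_tmul', ← map_smul, Submodule.mkQ_apply,
          (Submodule.Quotient.mk_eq_zero J).2 (Submodule.smul_mem_smul ha trivial), zero_tmul]
        exact zero_mem _
    rwa [hbot, Submodule.mem_bot] at hmap
  have h1 : L.mkQ.rTensor M w = 0 := by
    apply hjM
    rw [map_zero, ← h0, ← LinearMap.comp_apply, ← LinearMap.comp_apply, ← LinearMap.rTensor_comp,
      ← LinearMap.rTensor_comp, Submodule.mapQ_mkQ]
  -- `w` dies in `(N / L) ⊗ M`, hence comes from `L ⊗ M`, where `L ≤ 𝔞 ^ k N`.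
  obtain ⟨t, rfl⟩ := (rTensor_exact M (LinearMap.exact_subtype_mkQ L)
    (Submodule.mkQ_surjective L) w).1 h1
  clear hw h0 h1
  induction t with
  | zero => simp
  | add s t hs ht => rw [map_add]; exact add_mem hs ht
  | tmul y z =>
    exact Submodule.map_mem_smul_top _ ((TensorProduct.mk A N M).flip z) (hL y.2)

theorem IsPrecomplete.of_surjective {A X Y : Type*} [CommRing A] [AddCommGroup X] [Module A X]
    [AddCommGroup Y] [Module A Y] (I : Ideal A) [IsPrecomplete I X] {f : X →ₗ[A] Y}
    (hf : Function.Surjective f) : IsPrecomplete I Y := by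
  rw [← AdicCompletion.of_surjective_iff]
  intro y
  obtain ⟨x, rfl⟩ := AdicCompletion.map_surjective I hf y
  obtain ⟨x, rfl⟩ := AdicCompletion.of_surjective I X x
  exact ⟨f x, (AdicCompletion.map_of I f x).symm⟩

theorem Pi.mem_smul_top {A X ι : Type*} [CommRing A] [AddCommGroup X] [Module A X]
    [Finite ι] (I : Ideal A) {x : ι → X} (hx : ∀ i, x i ∈ I • (⊤ : Submodule A X)) :
    x ∈ I • (⊤ : Submodule A (ι → X)) := by
  classical
  cases nonempty_fintype ι
  rw [← Finset.univ_sum_single x]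
  exact sum_mem fun i _ => Submodule.map_mem_smul_top I (LinearMap.single A (fun _ => X) i) (hx i)

theorem IsAdicComplete.pi {A X ι : Type*} [CommRing A] [AddCommGroup X] [Module A X]
    [Finite ι] (I : Ideal A) [IsAdicComplete I X] : IsAdicComplete I (ι → X) where
  haus' x hx := by
    ext i
    refine IsHausdorff.haus (I := I) inferInstance _ fun n => ?_
    rw [SModEq.zero]
    exact Submodule.map_mem_smul_top _ (LinearMap.proj i) (SModEq.zero.1 (hx n))
  prec' f hf := by
    have h (i : ι) : ∃ L : X, ∀ n, f n i ≡ L [SMOD (I ^ n • ⊤ : Submodule A X)] := by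
      refine IsPrecomplete.prec inferInstance fun {m n} hmn => ?_
      rw [SModEq.sub_mem]
      exact Submodule.map_mem_smul_top _ (LinearMap.proj i) (SModEq.sub_mem.1 (hf hmn))
    choose L hL using h
    refine ⟨L, fun n => ?_⟩
    rw [SModEq.sub_mem]
    exact Pi.mem_smul_top _ fun i => SModEq.sub_mem.1 (hL i n)

theorem IsHausdorff.of_injective {A X Y : Type*} [CommRing A] [AddCommGroup X] [Module A X]
    [AddCommGroup Y] [Module A Y] (I : Ideal A) [IsHausdorff I Y] {f : X →ₗ[A] Y}
    (hf : Function.Injective f) : IsHausdorff I X where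
  haus' x hx := by
    apply hf
    rw [map_zero]
    refine IsHausdorff.haus (I := I) inferInstance _ fun n => ?_
    rw [SModEq.zero]
    exact Submodule.map_mem_smul_top _ f (SModEq.zero.1 (hx n))

/-- A quotient of a Hausdorff module by the image of a precomplete module is Hausdorff
if the preimage topology is at least as fine as the adic one. -/
theorem IsHausdorff.of_exact {A X Y Z : Type*} [CommRing A] [AddCommGroup X] [Module A X]
    [AddCommGroup Y] [Module A Y] [AddCommGroup Z] [Module A Z] (I : Ideal A)
    [IsPrecomplete I X] [IsHausdorff I Y] {f : X →ₗ[A] Y} {g : Y →ₗ[A] Z}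
    (hfg : Function.Exact f g) (hg : Function.Surjective g)
    (h : ∀ k : ℕ, ∃ m : ℕ, ∀ x : X, f x ∈ I ^ m • (⊤ : Submodule A Y) →
      x ∈ I ^ k • (⊤ : Submodule A X)) : IsHausdorff I Z where
  haus' z hz := by
    obtain ⟨y, rfl⟩ := hg z
    have key (m : ℕ) : ∃ x : X, y - f x ∈ I ^ m • (⊤ : Submodule A Y) := by
      obtain ⟨y', hy', e⟩ := Submodule.exists_mem_smul_top_map_eq (I ^ m) hg (SModEq.zero.1 (hz m))
      obtain ⟨x, hx⟩ := (hfg (y - y')).1 (by rw [map_sub, e, sub_self])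
      exact ⟨x, by rwa [hx, sub_sub_cancel]⟩
    have hmono {m n : ℕ} (hmn : m ≤ n) : I ^ n • (⊤ : Submodule A Y) ≤ I ^ m • ⊤ :=
      Submodule.smul_mono_left (Ideal.pow_le_pow_right hmn)
    choose μ hμ using h
    -- A monotone bound for both `μ` and the identity: `μ ≤ ν` makes the approximants `x k` Cauchy
    -- in `X`, and `k ≤ ν k` makes `f (x k)` converge to `y`.
    let ν : ℕ → ℕ := fun k => k + ∑ i ∈ Finset.range (k + 1), μ i
    have hν : Monotone ν := fun a b hab => add_le_add hab
      (Finset.sum_le_sum_of_subset (Finset.range_mono (Nat.succ_le_succ hab)))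
    have hμν (k : ℕ) : μ k ≤ ν k :=
      (Finset.single_le_sum (f := μ) (fun _ _ => Nat.zero_le _)
        (Finset.self_mem_range_succ k)).trans (Nat.le_add_left _ _)
    choose x hx using fun k => key (ν k)
    obtain ⟨p, hp⟩ := IsPrecomplete.prec (I := I) (M := X) inferInstance (f := x) (by
      intro m n hmn
      rw [SModEq.sub_mem]
      apply hμ
      have h1 := hmono (hμν m) (hx m)
      have h2 := hmono ((hμν m).trans (hν hmn)) (hx n)
      simpa using sub_mem h2 h1)
    have hy : y - f p = 0 := by
      refine IsHausdorff.haus (I := I) inferInstance _ fun n => ?_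
      rw [SModEq.zero]
      have h1 := hmono (Nat.le_add_right n _) (hx n)
      have h2 := Submodule.map_mem_smul_top _ f (SModEq.sub_mem.1 (hp n))
      simpa using add_mem h1 h2
    rw [sub_eq_zero.1 hy, hfg.apply_apply_eq_zero]

open TensorProduct in
theorem IsAdicComplete.piScalar_tensorProduct {A M : Type*} [CommRing A] [AddCommGroup M]
    [Module A M] (I : Ideal A) [IsAdicComplete I M] (n : ℕ) :
    IsAdicComplete I ((Fin n → A) ⊗[A] M) := by
  let e : (Fin n → A) ⊗[A] M ≃ₗ[A] (Fin n → M) :=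
    TensorProduct.comm A _ _ ≪≫ₗ TensorProduct.piScalarRight A A M (Fin n)
  have := IsAdicComplete.pi (X := M) (ι := Fin n) I
  have := IsHausdorff.of_injective I (f := e.toLinearMap) e.injective
  have := IsPrecomplete.of_surjective I (f := e.symm.toLinearMap) e.symm.surjective
  exact {}

-- `N ⊗ M` is a quotient of `M ^ n`, and precompleteness, unlike Hausdorffness, passes to all
-- quotients.
open TensorProduct in
theorem IsPrecomplete.tensorProduct {A M N : Type*} [CommRing A] [AddCommGroup M]
    [Module A M] [AddCommGroup N] [Module A N] [Module.Finite A N] (I : Ideal A)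
    [IsAdicComplete I M] : IsPrecomplete I (N ⊗[A] M) := by
  obtain ⟨n, f, hf⟩ := Module.Finite.exists_fin' A N
  have := IsAdicComplete.piScalar_tensorProduct (M := M) I n
  exact IsPrecomplete.of_surjective I (LinearMap.rTensor_surjective M hf)

open TensorProduct in
theorem IsAdicallyFlat.isHausdorff_tensorProduct {A : Type u} [CommRing A] [IsNoetherianRing A]
    {𝔞 : Ideal A} {M N : Type u} [AddCommGroup M] [Module A M] [AddCommGroup N] [Module A N]
    [Module.Finite A N] [IsAdicComplete 𝔞 M] (hM : IsAdicallyFlat 𝔞 M) :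
    IsHausdorff 𝔞 (N ⊗[A] M) := by
  obtain ⟨n, f, hf⟩ := Module.Finite.exists_fin' A N
  have := IsAdicComplete.piScalar_tensorProduct (M := M) 𝔞 n
  have := IsPrecomplete.tensorProduct (M := M) (N := LinearMap.ker f) 𝔞
  exact IsHausdorff.of_exact 𝔞 (rTensor_exact M f.exact_subtype_ker_map hf)
    (LinearMap.rTensor_surjective M hf) (hM.exists_rTensor_mem_pow_smul_imp f.ker)

theorem corollary5p10 {A : Type u} [CommRing A] [IsNoetherianRing A] (𝔞 : Ideal A)
    (M : Type u) [AddCommGroup M] [Module A M]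
    (hflat : IsAdicallyFlat 𝔞 M) (hcomplete : IsAdicComplete 𝔞 M) :
    Module.Flat A M := by
  rw [Module.Flat.iff_rTensor_injective]
  intro I _
  have := hflat.isHausdorff_tensorProduct (N := I)
  rw [injective_iff_map_eq_zero]
  intro x hx
  refine IsHausdorff.haus (I := 𝔞) inferInstance _ fun k => ?_
  rw [SModEq.zero]
  obtain ⟨m, hm⟩ := hflat.exists_rTensor_mem_pow_smul_imp I k
  exact hm x (by rw [hx]; exact zero_mem _)
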